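/- For $\nu,t\in\mathbb{C}$ with $t\neq 0$, let $$I_\nu(t)=\left(\frac t2\right)^{\nu}\sum_{k=0}^{\infty}\frac{(t^2/4)^k}{k!\,\Gamma(\nu+k+1)}$$ be the modified Bessel function of the first kind (principal branch of $(t/2)^\nu$, $-\pi<\arg t\le\pi$; $1/\Gamma$ is $0$ at the poles of $\Gamma$), and let $$K_\nu(t)=\frac{\pi}{2}\,\frac{I_{-\nu}(t)-I_\nu(t)}{\sin \pi\nu}$$ be the modified Bessel function of the second kind, where for integer $\nu$ the right-hand side is replaced by its limit as the order tends to $\nu$. Then, for every integer $m\ge 0$ and every $t\in\mathbb{C}\setminus\{0\}$, the function $\nu\mapsto K_\nu(t)$ is (complex) differentiable at $\nu=m$ and at $\nu=-m$, and $$\left.\frac{\partial K_\nu(t)}{\partial \nu}\right|_{\nu=\pm m}=\pm\frac{m!}{2}\sum_{k=0}^{m-1}\frac{K_k(t)}{k!\,(m-k)}\left(\frac t2\right)^{k-m},$$ with the same sign on both sides (for $m=0$ the sum is empty and the derivative is $0$). -/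

import Mathlib

open Filter Topology

/-- The modified Bessel function of the first kind
`I_ν(t) = (t/2)^ν ∑_{k ≥ 0} (t²/4)^k / (k! Γ(ν+k+1))`, of complex order `ν` and complex argument
`t`, with the principal branch `(t/2)^ν = exp (ν log (t/2))`, `-π < arg t ≤ π`. The terms in which
`Γ` has a pole are `0`, as they should be: Mathlib's `Complex.Gamma` is `0` at its poles
and `x / 0 = 0`. -/
noncomputable def besselI (ν t : ℂ) : ℂ :=
  (t / 2) ^ ν * ∑' k : ℕ, (t ^ 2 / 4) ^ k / ((k.factorial : ℂ) * Complex.Gamma (ν + k + 1))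

/-- The quotient `(π/2) (I_{-ν}(t) - I_ν(t)) / sin (π ν)`, meaningful for `ν` not an integer. -/
noncomputable def besselKAux (ν t : ℂ) : ℂ :=
  (Real.pi : ℂ) / 2 * ((besselI (-ν) t - besselI ν t) / Complex.sin (Real.pi * ν))

open Classical in
/-- The modified Bessel function of the second kind (Macdonald function) `K_ν(t)`:
`(π/2) (I_{-ν}(t) - I_ν(t)) / sin (π ν)` if `ν` is not an integer, and the limit of this
expression as the order tends to `ν` if `ν` is an integer. -/
noncomputable def besselK (ν t : ℂ) : ℂ :=
  if ∃ n : ℤ, ν = n then limUnder (𝓝[≠] ν) (fun μ : ℂ => besselKAux μ t) else besselKAux ν t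

/-! For fixed `t ≠ 0`, `K_ν(t)` is entire and even in `ν` and satisfies `K_{ν+1} = K_{ν-1} + (2ν/t)
K_ν`. Differentiating in `ν` gives an inhomogeneous three-term recurrence for `D_ν = ∂K_ν/∂ν`.
Evenness makes `D` odd, which fixes `D_0 = 0` and `D_1`. The claimed finite sum satisfies the same
recurrence (`orderDerivSum_recurrence`), so induction gives order `m` and oddness gives `-m`. -/

/-! ### Analyticity of `I_ν` in the order -/

theorem besselI_coeff_bound (R : ℝ) :
    ∃ C : ℝ, ∀ k : ℕ, ∀ ν ∈ Metric.closedBall (0 : ℂ) R,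
      ‖(Complex.Gamma (ν + k + 1))⁻¹‖ ≤ C := by
  have compact_bound : ∀ k : ℕ, ∃ C : ℝ, ∀ ν ∈ Metric.closedBall (0 : ℂ) R,
      ‖(Complex.Gamma (ν + k + 1))⁻¹‖ ≤ C := fun k =>
    (isCompact_closedBall (0 : ℂ) R).exists_bound_of_continuousOn
      ((Complex.differentiable_one_div_Gamma.continuous.comp
        (by fun_prop : Continuous fun ν : ℂ => ν + k + 1)).continuousOn)
  choose C hC using compact_bound
  obtain ⟨N, hN⟩ := exists_nat_ge R
  have tail : ∀ j : ℕ, ∀ ν ∈ Metric.closedBall (0 : ℂ) R,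
      ‖(Complex.Gamma (ν + (N + j : ℕ) + 1))⁻¹‖ ≤ C N := by
    intro j ν hν
    induction j with
    | zero => exact hC N ν hν
    | succ j ih =>
      have hrec := Complex.one_div_Gamma_eq_self_mul_one_div_Gamma_add_one (ν + (N + j : ℕ) + 1)
      -- Since `N ≥ R ≥ ‖ν‖`, each functional-equation step beyond `N` divides by a factor of
      -- modulus at least `1`, so the bound at `N` persists.
      have hge : 1 ≤ ‖ν + (N + j : ℕ) + 1‖ := by
        have h1 : ‖((N + j + 1 : ℕ) : ℂ)‖ ≤ ‖ν + (N + j : ℕ) + 1‖ + ‖ν‖ := by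
          refine le_trans (le_of_eq ?_) (norm_sub_le _ _)
          congr 1
          push_cast
          ring
        rw [Complex.norm_natCast] at h1
        have h2 : ‖ν‖ ≤ R := by simpa using hν
        push_cast at h1 ⊢
        have : (0 : ℝ) ≤ j := j.cast_nonneg
        linarith
      rw [hrec, norm_mul] at ih
      have heq : ν + (N + (j + 1) : ℕ) + 1 = ν + (N + j : ℕ) + 1 + 1 := by push_cast; ring
      rw [heq]
      exact (le_mul_of_one_le_left (norm_nonneg _) hge).trans ih
  refine ⟨∑ k ∈ Finset.range (N + 1), |C k|, ?_⟩
  intro k ν hν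
  have single : ∀ i ≤ N, C i ≤ ∑ k ∈ Finset.range (N + 1), |C k| := fun i hi =>
    (le_abs_self _).trans (Finset.single_le_sum (f := fun k => |C k|)
      (fun _ _ => abs_nonneg _) (Finset.mem_range.2 (Nat.lt_succ_of_le hi)))
  rcases le_total k N with h | h
  · exact (hC k ν hν).trans (single k h)
  · obtain ⟨j, rfl⟩ := Nat.exists_eq_add_of_le h
    exact (tail j ν hν).trans (single N le_rfl)

theorem norm_besselI_term_le {C : ℝ} {ν : ℂ} {k : ℕ}
    (h : ‖(Complex.Gamma (ν + k + 1))⁻¹‖ ≤ C) (w : ℂ) :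
    ‖w ^ k / ((k.factorial : ℂ) * Complex.Gamma (ν + k + 1))‖ ≤ C * (‖w‖ ^ k / k.factorial) := by
  rw [← div_div, div_eq_mul_inv (_ / _), norm_mul, norm_div, norm_pow, Complex.norm_natCast,
    mul_comm]
  gcongr

theorem summable_besselI_terms (ν w : ℂ) :
    Summable fun k : ℕ => w ^ k / ((k.factorial : ℂ) * Complex.Gamma (ν + k + 1)) := by
  obtain ⟨C, hC⟩ := besselI_coeff_bound ‖ν‖
  exact Summable.of_norm_bounded ((Real.summable_pow_div_factorial ‖w‖).mul_left C)
    fun k => norm_besselI_term_le (hC k ν (by simp)) w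

theorem differentiable_besselI_series (w : ℂ) :
    Differentiable ℂ fun ν : ℂ =>
      ∑' k : ℕ, w ^ k / ((k.factorial : ℂ) * Complex.Gamma (ν + k + 1)) := by
  intro ν
  obtain ⟨C, hC⟩ := besselI_coeff_bound (‖ν‖ + 1)
  have hd : DifferentiableOn ℂ (fun ν : ℂ =>
      ∑' k : ℕ, w ^ k / ((k.factorial : ℂ) * Complex.Gamma (ν + k + 1)))
      (Metric.ball 0 (‖ν‖ + 1)) := by
    refine Complex.differentiableOn_tsum_of_summable_norm
      ((Real.summable_pow_div_factorial ‖w‖).mul_left C) (fun k => ?_) Metric.isOpen_ball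
      fun k μ hμ => norm_besselI_term_le (hC k μ (Metric.ball_subset_closedBall hμ)) w
    have : Differentiable ℂ fun μ : ℂ => w ^ k / (k.factorial : ℂ) *
        (Complex.Gamma (μ + k + 1))⁻¹ :=
      (Complex.differentiable_one_div_Gamma.comp
        (by fun_prop : Differentiable ℂ fun μ : ℂ => μ + k + 1)).const_mul _
    simpa only [div_eq_mul_inv, mul_inv, mul_assoc] using this.differentiableOn
  exact hd.differentiableAt (Metric.isOpen_ball.mem_nhds (by simp))

theorem differentiable_besselI {t : ℂ} (ht : t ≠ 0) :
    Differentiable ℂ fun ν : ℂ => besselI ν t := by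
  have h2 : t / 2 ≠ 0 := div_ne_zero ht two_ne_zero
  have hp : Differentiable ℂ fun ν : ℂ => (t / 2) ^ ν := fun ν =>
    differentiableAt_id.const_cpow (Or.inl h2)
  exact hp.mul (differentiable_besselI_series (t ^ 2 / 4))

/-! ### Recurrence and integer reflection for `I_ν` -/

/-- The three-term recurrence of the power series in `besselI`. -/
theorem besselI_series_recurrence (ν w : ℂ) :
    ∑' k : ℕ, w ^ k / ((k.factorial : ℂ) * Complex.Gamma (ν - 1 + k + 1)) -
      w * ∑' k : ℕ, w ^ k / ((k.factorial : ℂ) * Complex.Gamma (ν + 1 + k + 1)) =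
    ν * ∑' k : ℕ, w ^ k / ((k.factorial : ℂ) * Complex.Gamma (ν + k + 1)) := by
  set f : ℕ → ℂ := fun k => w ^ k / ((k.factorial : ℂ) * Complex.Gamma (ν + k + 1)) with hf
  set g : ℕ → ℂ := fun k => w ^ k / ((k.factorial : ℂ) * Complex.Gamma (ν + 1 + k + 1)) with hg
  have hshift : ∀ k : ℕ, ((k + 1 : ℕ) : ℂ) * f (k + 1) = w * g k := by
    intro k
    have hk : ((k + 1 : ℕ) : ℂ) ≠ 0 := Nat.cast_ne_zero.2 k.succ_ne_zero
    have hk' : (k.factorial : ℂ) ≠ 0 := Nat.cast_ne_zero.2 k.factorial_ne_zero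
    have harg : ν + (k + 1 : ℕ) + 1 = ν + 1 + k + 1 := by push_cast; ring
    simp only [hf, hg, harg, Nat.factorial_succ, Nat.cast_mul, pow_succ, ← div_div]
    field_simp
  have hwg : Summable fun k : ℕ => w * g k := (summable_besselI_terms (ν + 1) w).mul_left w
  have hkf : Summable fun k : ℕ => (k : ℂ) * f k :=
    (summable_nat_add_iff 1).1 (by simpa only [hshift] using hwg)
  have hsum : ∑' k : ℕ, (k : ℂ) * f k = w * ∑' k, g k := by
    rw [hkf.tsum_eq_zero_add, ← tsum_mul_left]
    simp only [hshift, Nat.cast_zero, zero_mul, zero_add]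
  -- `1/Γ(ν+k) = (ν+k)/Γ(ν+k+1)` splits the term; the `k` part is the shifted series of order `ν+1`.
  have hfirst : ∀ k : ℕ, w ^ k / ((k.factorial : ℂ) * Complex.Gamma (ν - 1 + k + 1)) =
      ν * f k + k * f k := by
    intro k
    have hrec := Complex.one_div_Gamma_eq_self_mul_one_div_Gamma_add_one (ν + k)
    have harg : ν - 1 + k + 1 = ν + k := by ring
    simp only [hf, harg, ← div_div]
    rw [div_eq_mul_inv _ (Complex.Gamma (ν + k)), hrec]
    ring
  rw [tsum_congr hfirst, ((summable_besselI_terms ν w).mul_left ν).tsum_add hkf, hsum,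
    tsum_mul_left]
  ring

theorem besselI_recurrence {t : ℂ} (ht : t ≠ 0) (ν : ℂ) :
    besselI (ν - 1) t - besselI (ν + 1) t = ν / (t / 2) * besselI ν t := by
  have h2 : t / 2 ≠ 0 := div_ne_zero ht two_ne_zero
  have h := besselI_series_recurrence ν (t ^ 2 / 4)
  unfold besselI
  rw [Complex.cpow_sub _ _ h2, Complex.cpow_add _ _ h2, Complex.cpow_one]
  rw [div_mul_eq_mul_div ν, eq_div_iff h2, sub_mul, mul_right_comm, div_mul_cancel₀ _ h2]
  linear_combination (t / 2) ^ ν * h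

theorem besselI_neg_natCast {t : ℂ} (ht : t ≠ 0) (n : ℕ) :
    besselI (-(n : ℂ)) t = besselI n t := by
  have h2 : t / 2 ≠ 0 := div_ne_zero ht two_ne_zero
  have hw : t ^ 2 / 4 = (t / 2) ^ 2 := by ring
  unfold besselI
  rw [← (summable_besselI_terms (-(n : ℂ)) (t ^ 2 / 4)).sum_add_tsum_nat_add n,
    Finset.sum_eq_zero, zero_add, ← tsum_mul_left, ← tsum_mul_left]
  · refine tsum_congr fun k => ?_
    have h1 : -(n : ℂ) + ((k + n : ℕ) : ℂ) + 1 = (k : ℂ) + 1 := by push_cast; ring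
    have h3 : (n : ℂ) + (k : ℂ) + 1 = ((k + n : ℕ) : ℂ) + 1 := by push_cast; ring
    rw [h1, h3, Complex.Gamma_nat_eq_factorial, Complex.Gamma_nat_eq_factorial, Complex.cpow_neg,
      Complex.cpow_natCast, hw, pow_add, ← pow_mul (t / 2) 2 n, mul_comm 2 n, pow_mul _ n 2,
      mul_comm (k.factorial : ℂ)]
    field_simp
  -- The terms `k < n` sit at poles of `Γ`, where the junk values make them `0`.
  · intro k hk
    have hkn := Finset.mem_range.1 hk
    have : -(n : ℂ) + k + 1 = -((n - k - 1 : ℕ) : ℂ) := by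
      rw [Nat.sub_sub, Nat.cast_sub hkn]
      push_cast
      ring
    rw [this, Complex.Gamma_neg_nat_eq_zero, mul_zero, div_zero]

theorem besselI_neg_intCast {t : ℂ} (ht : t ≠ 0) (n : ℤ) :
    besselI (-(n : ℂ)) t = besselI n t := by
  obtain ⟨k, rfl | rfl⟩ := n.eq_nat_or_neg
  · simpa using besselI_neg_natCast ht k
  · simpa using (besselI_neg_natCast ht k).symm

/-! ### `K_ν` is entire in the order -/

theorem sin_pi_mul_eq_zero_iff (ν : ℂ) :
    Complex.sin (Real.pi * ν) = 0 ↔ ∃ n : ℤ, ν = n := by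
  have hpi : (Real.pi : ℂ) ≠ 0 := Complex.ofReal_ne_zero.2 Real.pi_ne_zero
  rw [Complex.sin_eq_zero_iff]
  refine exists_congr fun n => ?_
  rw [mul_comm, mul_left_inj' hpi]

theorem besselK_of_not_int {ν : ℂ} (h : ¬∃ n : ℤ, ν = n) (t : ℂ) :
    besselK ν t = besselKAux ν t := if_neg h

theorem hasDerivAt_sin_pi_mul (ν : ℂ) :
    HasDerivAt (fun μ : ℂ => Complex.sin (Real.pi * μ))
      (Complex.cos (Real.pi * ν) * Real.pi) ν := by
  simpa using ((hasDerivAt_id ν).const_mul (Real.pi : ℂ)).csin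

theorem cos_pi_mul_intCast_ne_zero (n : ℤ) : Complex.cos (Real.pi * n) ≠ 0 := by
  intro h
  have hs := (sin_pi_mul_eq_zero_iff n).2 ⟨n, rfl⟩
  simpa [h, hs] using Complex.sin_sq_add_cos_sq ((Real.pi : ℂ) * n)

theorem eventually_nhds_not_int {ν : ℂ} (h : ¬∃ n : ℤ, ν = n) :
    ∀ᶠ μ : ℂ in 𝓝 ν, ¬∃ n : ℤ, μ = n := by
  have hν : Complex.sin (Real.pi * ν) ≠ 0 := by rwa [Ne, sin_pi_mul_eq_zero_iff]
  filter_upwards [(hasDerivAt_sin_pi_mul ν).continuousAt.eventually_ne hν] with μ hμ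
  rwa [← sin_pi_mul_eq_zero_iff]

theorem eventually_nhdsNE_not_int (n : ℤ) :
    ∀ᶠ μ : ℂ in 𝓝[≠] (n : ℂ), ¬∃ k : ℤ, μ = k := by
  have hne : Complex.cos (Real.pi * n) * Real.pi ≠ 0 :=
    mul_ne_zero (cos_pi_mul_intCast_ne_zero n) (Complex.ofReal_ne_zero.2 Real.pi_ne_zero)
  filter_upwards [(hasDerivAt_sin_pi_mul n).eventually_ne (c := 0) hne] with μ hμ
  rwa [← sin_pi_mul_eq_zero_iff]

theorem differentiableAt_besselKAux {t : ℂ} (ht : t ≠ 0) {ν : ℂ} (h : ¬∃ n : ℤ, ν = n) :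
    DifferentiableAt ℂ (fun μ : ℂ => besselKAux μ t) ν := by
  have hs : Complex.sin (Real.pi * ν) ≠ 0 := by rwa [Ne, sin_pi_mul_eq_zero_iff]
  have hI := differentiable_besselI ht
  exact (((hI.comp differentiable_neg ν).sub (hI ν)).div
    (hasDerivAt_sin_pi_mul ν).differentiableAt hs).const_mul _

theorem differentiableAt_besselK_of_not_int {t : ℂ} (ht : t ≠ 0) {ν : ℂ}
    (h : ¬∃ n : ℤ, ν = n) : DifferentiableAt ℂ (fun μ : ℂ => besselK μ t) ν := by
  refine (differentiableAt_besselKAux ht h).congr_of_eventuallyEq ?_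
  filter_upwards [eventually_nhds_not_int h] with μ hμ using besselK_of_not_int hμ t

/-- The limit that defines `besselK` at the integers exists. -/
theorem exists_tendsto_besselKAux {t : ℂ} (ht : t ≠ 0) (n : ℤ) :
    ∃ c : ℂ, Tendsto (fun μ : ℂ => besselKAux μ t) (𝓝[≠] (n : ℂ)) (𝓝 c) := by
  have hI := differentiable_besselI ht
  have hN : DifferentiableAt ℂ (fun μ : ℂ => besselI (-μ) t - besselI μ t) n :=
    (hI.comp differentiable_neg n).sub (hI n)
  have hne : Complex.cos (Real.pi * n) * Real.pi ≠ 0 :=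
    mul_ne_zero (cos_pi_mul_intCast_ne_zero n) (Complex.ofReal_ne_zero.2 Real.pi_ne_zero)
  -- Numerator and sine both vanish at `n`, and the zero of the sine is simple, so the quotient is a
  -- quotient of slopes.
  have hlim := ((hasDerivAt_iff_tendsto_slope.1 hN.hasDerivAt).div
    (hasDerivAt_iff_tendsto_slope.1 (hasDerivAt_sin_pi_mul n)) hne).const_mul
      ((Real.pi : ℂ) / 2)
  refine ⟨_, hlim.congr' ?_⟩
  filter_upwards [self_mem_nhdsWithin] with μ hμ
  have hμ' : μ - n ≠ 0 := sub_ne_zero.2 hμ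
  have hs : Complex.sin (Real.pi * n) = 0 := (sin_pi_mul_eq_zero_iff n).2 ⟨n, rfl⟩
  simp only [Pi.div_apply, slope_def_field, besselI_neg_intCast ht n, hs, sub_self, sub_zero,
    besselKAux]
  rw [div_div_div_cancel_right₀ hμ']

/-- The integers are removable singularities: the value there is the limit. -/
theorem differentiable_besselK {t : ℂ} (ht : t ≠ 0) :
    Differentiable ℂ fun ν : ℂ => besselK ν t := by
  intro ν
  by_cases h : ∃ n : ℤ, ν = n
  · obtain ⟨n, rfl⟩ := h
    obtain ⟨c, hc⟩ := exists_tendsto_besselKAux ht n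
    refine (Complex.analyticAt_of_differentiable_on_punctured_nhds_of_continuousAt
      ?_ ?_).differentiableAt
    · filter_upwards [eventually_nhdsNE_not_int n] with μ hμ
        using differentiableAt_besselK_of_not_int ht hμ
    · have hval : besselK n t = c := by
        rw [besselK, if_pos ⟨n, rfl⟩]
        exact hc.limUnder_eq
      rw [continuousAt_iff_punctured_nhds, hval]
      refine hc.congr' ?_
      filter_upwards [eventually_nhdsNE_not_int n] with μ hμ using (besselK_of_not_int hμ t).symm
  · exact differentiableAt_besselK_of_not_int ht h

/-! ### Evenness and recurrence for `K_ν` and its order derivative -/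

theorem eq_of_continuous_of_eq_off_int {f g : ℂ → ℂ} (hf : Continuous f) (hg : Continuous g)
    (h : ∀ ν : ℂ, (¬∃ n : ℤ, ν = n) → f ν = g ν) : f = g := by
  have hd : Dense (Set.range ((↑) : ℤ → ℂ))ᶜ := (Set.countable_range _).dense_compl ℝ
  refine hf.ext_on hd hg fun ν hν => h ν ?_
  rintro ⟨n, rfl⟩
  exact hν ⟨n, rfl⟩

theorem besselK_neg {t : ℂ} (ht : t ≠ 0) (ν : ℂ) : besselK (-ν) t = besselK ν t := by
  have hK := (differentiable_besselK ht).continuous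
  refine congrFun (eq_of_continuous_of_eq_off_int (hK.comp continuous_neg) hK fun ν h => ?_) ν
  have h' : ¬∃ n : ℤ, -ν = n := fun ⟨n, hn⟩ => h ⟨-n, by push_cast; rw [← hn, neg_neg]⟩
  simp only [Function.comp_apply]
  rw [besselK_of_not_int h, besselK_of_not_int h', besselKAux, besselKAux, neg_neg, mul_neg,
    Complex.sin_neg, div_neg, ← neg_div, neg_sub]

theorem besselK_recurrence {t : ℂ} (ht : t ≠ 0) (ν : ℂ) :
    besselK (ν + 1) t = besselK (ν - 1) t + ν / (t / 2) * besselK ν t := by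
  have hK := (differentiable_besselK ht).continuous
  refine congrFun (eq_of_continuous_of_eq_off_int
    (f := fun ν => besselK (ν + 1) t)
    (g := fun ν => besselK (ν - 1) t + ν / (t / 2) * besselK ν t)
    (hK.comp (by fun_prop)) ((hK.comp (by fun_prop)).add (Continuous.mul (by fun_prop) hK))
    fun ν h => ?_) ν
  have hadd : ¬∃ n : ℤ, ν + 1 = n := fun ⟨n, hn⟩ =>
    h ⟨n - 1, by push_cast; rw [← hn, add_sub_cancel_right]⟩
  have hsub : ¬∃ n : ℤ, ν - 1 = n := fun ⟨n, hn⟩ =>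
    h ⟨n + 1, by push_cast; rw [← hn, sub_add_cancel]⟩
  have hs : Complex.sin (Real.pi * ν) ≠ 0 := by rwa [Ne, sin_pi_mul_eq_zero_iff]
  have h1 := besselI_recurrence ht ν
  have h2 := besselI_recurrence ht (-ν)
  rw [besselK_of_not_int h, besselK_of_not_int hadd, besselK_of_not_int hsub]
  unfold besselKAux
  rw [mul_add, mul_sub (Real.pi : ℂ) ν 1, mul_one, Complex.sin_add_pi, Complex.sin_sub_pi,
    neg_add', neg_sub', sub_neg_eq_add]
  field_simp
  field_simp at h1 h2
  -- Shifting the order by `±1` flips the sign of the sine, so the recurrences of `I` at `ν` and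
  -- `-ν` combine.
  linear_combination (-1 : ℂ) * h1 - h2

theorem deriv_besselK_neg {t : ℂ} (ht : t ≠ 0) (ν : ℂ) :
    deriv (fun μ : ℂ => besselK μ t) (-ν) = -deriv (fun μ : ℂ => besselK μ t) ν := by
  have h := deriv_comp_neg (fun μ : ℂ => besselK μ t) ν
  simp only [besselK_neg ht] at h
  rw [h, neg_neg]

theorem deriv_besselK_recurrence {t : ℂ} (ht : t ≠ 0) (ν : ℂ) :
    deriv (fun μ : ℂ => besselK μ t) (ν + 1) =
      deriv (fun μ : ℂ => besselK μ t) (ν - 1) +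
        (besselK ν t / (t / 2) + ν / (t / 2) * deriv (fun μ : ℂ => besselK μ t) ν) := by
  have hK := fun μ => (differentiable_besselK ht μ).hasDerivAt
  have hl := (hK (ν + 1)).comp_add_const ν 1
  have hr := ((hK (ν - 1)).comp_sub_const ν 1).add
    (((hasDerivAt_id ν).div_const (t / 2)).mul (hK ν))
  have heq : (fun μ : ℂ => besselK (μ + 1) t) =
      (fun μ => besselK (μ - 1) t) + (fun μ => id μ / (t / 2)) * fun μ => besselK μ t := by
    funext μ
    exact besselK_recurrence ht μ
  rw [heq] at hl
  rw [hl.unique hr]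
  simp only [id]
  ring

/-! ### The finite sum and the induction on the order -/

/-- The right-hand side of the derivative formula, for an arbitrary sequence `K`. -/
noncomputable def orderDerivSum (K : ℕ → ℂ) (z : ℂ) (m : ℕ) : ℂ :=
  (m.factorial : ℂ) / 2 * ∑ k ∈ Finset.range m,
    K k / ((k.factorial : ℂ) * ((m : ℂ) - (k : ℂ))) * z ^ ((k : ℤ) - (m : ℤ))

/-- All three sums are expanded in the same terms `M j`, and coefficients are compared. -/
theorem orderDerivSum_recurrence {K : ℕ → ℂ} {z : ℂ} (hz : z ≠ 0)
    (hK : ∀ k : ℕ, K (k + 2) = K k + ((k : ℂ) + 1) / z * K (k + 1)) (n : ℕ) :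
    orderDerivSum K z (n + 2) = orderDerivSum K z n +
      (K (n + 1) / z + ((n : ℂ) + 1) / z * orderDerivSum K z (n + 1)) := by
  set M : ℕ → ℂ := fun j => K j / (j.factorial : ℂ) * z ^ ((j : ℤ) - ((n + 2 : ℕ) : ℤ)) with hM
  have h0 : orderDerivSum K z (n + 2) = ∑ j ∈ Finset.range (n + 2),
      (n.factorial : ℂ) / 2 * (((n : ℂ) + 1) * (n + 2) / (n + 2 - j)) * M j := by
    rw [orderDerivSum, Finset.mul_sum]
    refine Finset.sum_congr rfl fun j _ => ?_
    simp only [hM, Nat.factorial_succ, ← div_div]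
    push_cast
    ring
  have h1 : ((n : ℂ) + 1) / z * orderDerivSum K z (n + 1) = ∑ j ∈ Finset.range (n + 1),
      (n.factorial : ℂ) / 2 * (((n : ℂ) + 1) * (n + 1) / (n + 1 - j)) * M j := by
    rw [orderDerivSum, Finset.mul_sum, Finset.mul_sum]
    refine Finset.sum_congr rfl fun j _ => ?_
    have hp : z ^ ((j : ℤ) - ((n + 1 : ℕ) : ℤ)) = z ^ ((j : ℤ) - ((n + 2 : ℕ) : ℤ)) * z := by
      rw [← zpow_add_one₀ hz]
      congr 1
      push_cast
      ring
    simp only [hM, Nat.factorial_succ, ← div_div, hp]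
    push_cast
    field_simp
  -- Substitute `K k = K (k+2) - (k+1)/z * K (k+1)` and reindex by `j = k+2` and `j = k+1`; the
  -- factors `j(j-1)` and `j²` kill the added initial terms.
  have h2 : orderDerivSum K z n = ∑ j ∈ Finset.range (n + 2),
        (n.factorial : ℂ) / 2 * ((j : ℂ) * (j - 1) / (n + 2 - j)) * M j -
      ∑ j ∈ Finset.range (n + 1),
        (n.factorial : ℂ) / 2 * ((j : ℂ) * j / (n + 1 - j)) * M j := by
    rw [Finset.sum_range_succ', Finset.sum_range_succ', Finset.sum_range_succ' _ n,
      orderDerivSum, Finset.mul_sum]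
    simp only [Nat.cast_zero, zero_mul, zero_div, mul_zero, add_zero, zero_add, Nat.cast_one,
      sub_self]
    rw [← Finset.sum_sub_distrib]
    refine Finset.sum_congr rfl fun k hk => ?_
    have hkn : (n : ℂ) - k ≠ 0 :=
      sub_ne_zero.2 (Nat.cast_injective.ne (Finset.mem_range.1 hk).ne')
    have hkf : (k.factorial : ℂ) ≠ 0 := Nat.cast_ne_zero.2 k.factorial_ne_zero
    have hk1 : (k : ℂ) + 1 ≠ 0 := Nat.cast_add_one_ne_zero k
    have hk2 : (k : ℂ) + 1 + 1 ≠ 0 := by exact_mod_cast Nat.cast_add_one_ne_zero (R := ℂ) (k + 1)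
    have hp1 : z ^ (((k + 1 : ℕ) : ℤ) - ((n + 2 : ℕ) : ℤ)) = z ^ ((k : ℤ) - n) / z := by
      rw [div_eq_mul_inv, ← zpow_sub_one₀ hz]
      congr 1
      push_cast
      ring
    have hp2 : z ^ (((k + 1 + 1 : ℕ) : ℤ) - ((n + 2 : ℕ) : ℤ)) = z ^ ((k : ℤ) - n) := by
      congr 1
      push_cast
      ring
    have hd1 : (n : ℂ) + 2 - ((k + 1 + 1 : ℕ) : ℂ) = n - k := by push_cast; ring
    have hd2 : (n : ℂ) + 1 - ((k + 1 : ℕ) : ℂ) = n - k := by push_cast; ring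
    have hKk : K k = K (k + 1 + 1) - ((k : ℂ) + 1) / z * K (k + 1) := by
      rw [hK k]
      ring
    simp only [hM, hp1, hp2, hd1, hd2, Nat.factorial_succ, hKk]
    push_cast
    field_simp
    ring
  have hlast : M (n + 1) = K (n + 1) / (((n : ℂ) + 1) * n.factorial) / z := by
    have : ((n + 1 : ℕ) : ℤ) - ((n + 2 : ℕ) : ℤ) = -1 := by push_cast; ring
    simp only [hM, this, zpow_neg_one, Nat.factorial_succ]
    push_cast
    rfl
  have hn1 : (n : ℂ) + 1 ≠ 0 := Nat.cast_add_one_ne_zero n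
  have hnf : (n.factorial : ℂ) ≠ 0 := Nat.cast_ne_zero.2 n.factorial_ne_zero
  -- Both `((n+1)(n+2) - j(j-1))/(n+2-j)` and `((n+1)² - j²)/(n+1-j)` equal `n+1+j`.
  have hmain : ∀ j ∈ Finset.range (n + 1),
      (n.factorial : ℂ) / 2 * (((n : ℂ) + 1) * (n + 2) / (n + 2 - j)) * M j =
      (n.factorial : ℂ) / 2 * ((j : ℂ) * (j - 1) / (n + 2 - j)) * M j -
      (n.factorial : ℂ) / 2 * ((j : ℂ) * j / (n + 1 - j)) * M j +
      (n.factorial : ℂ) / 2 * (((n : ℂ) + 1) * (n + 1) / (n + 1 - j)) * M j := by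
    intro j hj
    have hjn := Finset.mem_range.1 hj
    have e1 : (n : ℂ) + 1 - j ≠ 0 := by
      have : ((n + 1 : ℕ) : ℂ) ≠ j := Nat.cast_injective.ne hjn.ne'
      push_cast at this
      exact sub_ne_zero.2 this
    have e2 : (n : ℂ) + 2 - j ≠ 0 := by
      have : ((n + 2 : ℕ) : ℂ) ≠ j := Nat.cast_injective.ne (by omega)
      push_cast at this
      exact sub_ne_zero.2 this
    field_simp
    ring
  have hbd : (n : ℂ) + 2 - ((n + 1 : ℕ) : ℂ) = 1 := by push_cast; ring
  -- The leftover terms `j = n+1` produce exactly `K (n+1) / z`.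
  rw [h0, h1, h2, Finset.sum_range_succ, Finset.sum_range_succ _ (n + 1), Finset.sum_congr rfl hmain,
    Finset.sum_add_distrib, Finset.sum_sub_distrib, hlast, hbd]
  push_cast
  field_simp
  ring

theorem deriv_besselK_natCast {t : ℂ} (ht : t ≠ 0) (m : ℕ) :
    deriv (fun μ : ℂ => besselK μ t) m = orderDerivSum (fun k => besselK k t) (t / 2) m := by
  have hz : t / 2 ≠ 0 := div_ne_zero ht two_ne_zero
  have hzero : deriv (fun μ : ℂ => besselK μ t) 0 = 0 := by
    have h := deriv_besselK_neg ht 0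
    rw [neg_zero] at h
    exact self_eq_neg.1 h
  have hK : ∀ k : ℕ, besselK ((k + 2 : ℕ) : ℂ) t =
      besselK k t + ((k : ℂ) + 1) / (t / 2) * besselK ((k + 1 : ℕ) : ℂ) t := by
    intro k
    have h := besselK_recurrence ht ((k : ℂ) + 1)
    rw [add_sub_cancel_right, add_assoc, one_add_one_eq_two] at h
    exact_mod_cast h
  induction m using Nat.twoStepInduction with
  | zero => simpa [orderDerivSum] using hzero
  | one =>
    -- At `ν = 0`, oddness turns the recurrence into `2 D_1 = K_0 / (t/2)`.
    have h := deriv_besselK_recurrence ht 0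
    rw [zero_add, zero_sub, deriv_besselK_neg ht 1, zero_div, zero_mul, add_zero] at h
    simp [orderDerivSum]
    linear_combination h / 2
  | more n ih0 ih1 =>
    have h := deriv_besselK_recurrence ht ((n : ℂ) + 1)
    rw [add_sub_cancel_right, add_assoc, one_add_one_eq_two] at h
    have hS := orderDerivSum_recurrence (K := fun k : ℕ => besselK (k : ℂ) t) hz hK n
    rw [hS, ← ih0, ← ih1]
    push_cast
    exact h

theorem mainTheorem11 (m : ℕ) (t : ℂ) (ht : t ≠ 0) :
    HasDerivAt (fun ν : ℂ => besselK ν t)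
      ((m.factorial : ℂ) / 2 * ∑ k ∈ Finset.range m,
        besselK (k : ℂ) t / ((k.factorial : ℂ) * ((m : ℂ) - (k : ℂ))) *
          (t / 2) ^ ((k : ℤ) - (m : ℤ)))
      (m : ℂ) ∧
    HasDerivAt (fun ν : ℂ => besselK ν t)
      (-((m.factorial : ℂ) / 2 * ∑ k ∈ Finset.range m,
        besselK (k : ℂ) t / ((k.factorial : ℂ) * ((m : ℂ) - (k : ℂ))) *
          (t / 2) ^ ((k : ℤ) - (m : ℤ))))
      (-(m : ℂ)) := by
  have hm := deriv_besselK_natCast ht m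
  have hneg := deriv_besselK_neg ht m
  rw [hm] at hneg
  have h := (differentiable_besselK ht m).hasDerivAt
  have h' := (differentiable_besselK ht (-(m : ℂ))).hasDerivAt
  rw [hm] at h
  rw [hneg] at h'
  exact ⟨h, h'⟩
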